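/- For integers $k>0$ and $L\ge 0$ let $S_k^{(0)}(N)=\sum_{n=1}^N n^k$ and $S_k^{(L)}(N)=\sum_{n=1}^N S_k^{(L-1)}(n)$ for $L\ge 1$ $(N=0,1,2,\dots)$. There is a unique polynomial in $N$ that takes these values at all integers $N\ge 0$; it is again denoted $S_k^{(L)}$. Put $y=N(N+L+1)$, $$A=(L \bmod 2)+((k+1)\bmod 2),\qquad m=L+3-(k\bmod 2),\qquad n=\left\lfloor\tfrac{k+1}{2}\right\rfloor ,$$ and consider the following real $n\times n$ matrices (rows and columns numbered from $1$): $I$ is the identity; $J$ is the lower shift matrix, $J_{ij}=\delta_{i,j+1}$; $P=\sum_{q\ge 0} J^q/(2q+1)!$; $D_m=\mathrm{diag}(m!,(m+2)!,\dots,(m+2n-2)!)$; and, for $0\le q\le n-1$, $K_q$ is the matrix whose only nonzero entry is a $1$ in position $(n-q,n)$. Then $$S_k^{(L)}=\frac{k!}{(L+k+1)!}\;\frac{\left(\sqrt{4y+(L+1)^2}\right)^{A}}{2^{k-1}\,(1+(L\bmod 2))}\;\prod_{q=0}^{\lfloor L/2\rfloor}\bigl[y+q(L+1-q)\bigr]\;\det\Bigl\{[I-(4y+(L+1)^2)J]\prod_{q=0}^{\lfloor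 L/2\rfloor}[I-(L+1-2q)^2J]\;D_mP^{L+1}D_m^{-1}-K_0+K_{n-1}\Bigr\}.$$ This holds with the nonnegative square root for all real $N\ge -(L+1)/2$ (in particular for all integers $N\ge 0$), and for all real $N$, as an identity of polynomials in $N$, when $\sqrt{4y+(L+1)^2}$ is read as $2N+L+1$. Moreover the zeros at $N=0,-1,\dots,-L-1$ are factored out: $$\frac{(2N+L+1)^{L\bmod 2}}{1+(L\bmod 2)}\prod_{q=0}^{\lfloor L/2\rfloor}\bigl[y+q(L+1-q)\bigr]=\prod_{j=0}^{L+1}(N+j).$$ -/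

import Mathlib

noncomputable section

namespace Hypersum

/-- The hypersum `S_k^{(L)}(N)`: `S_k^{(0)}(N) = ∑_{n=1}^N n^k` and
`S_k^{(L)}(N) = ∑_{n=1}^N S_k^{(L-1)}(n)` for `L ≥ 1`. -/
def hypersum (k : ℕ) : ℕ → ℕ → ℕ
  | 0, N => ∑ n ∈ Finset.Icc 1 N, n ^ k
  | L + 1, N => ∑ n ∈ Finset.Icc 1 N, hypersum k L n

/-- The lower shift matrix, truncated to size `n`: ones just below the diagonal. -/
def J (n : ℕ) : Matrix (Fin n) (Fin n) ℝ :=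
  Matrix.of fun i j => if (i : ℕ) = (j : ℕ) + 1 then 1 else 0

/-- The unit lower-triangular Toeplitz matrix `P = ∑_q J^q / (2q+1)!`, truncated to size `n`:
its entry in row `i` and column `j ≤ i` is `1 / (2(i-j)+1)!`. -/
def P (n : ℕ) : Matrix (Fin n) (Fin n) ℝ :=
  Matrix.of fun i j =>
    if j ≤ i then 1 / ((2 * ((i : ℕ) - (j : ℕ)) + 1).factorial : ℝ) else 0

/-- The diagonal matrix `D_m = diag (m!, (m+2)!, (m+4)!, …)`, truncated to size `n`. -/
def D (m n : ℕ) : Matrix (Fin n) (Fin n) ℝ :=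
  Matrix.diagonal fun i => ((m + 2 * (i : ℕ)).factorial : ℝ)

/-- The unit tower matrix `K_q` of size `n`: its only nonzero entry is a one in row `n - q` of
the last column, rows and columns being counted from `1`. -/
def K (q n : ℕ) : Matrix (Fin n) (Fin n) ℝ :=
  Matrix.of fun i j => if (i : ℕ) + 1 + q = n ∧ (j : ℕ) + 1 = n then 1 else 0

/-- The matrix `∏_{q=0}^{⌊L/2⌋} [I - (L+1-2q)^2 J]`, truncated to size `n`. -/
def shiftProd (L n : ℕ) : Matrix (Fin n) (Fin n) ℝ :=
  ((List.range (L / 2 + 1)).map fun q : ℕ => 1 - ((L : ℝ) + 1 - 2 * (q : ℝ)) ^ 2 • J n).prod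

/-- The `n × n` determinant
`det {[I - (4y+(L+1)^2) J] ∏_{q=0}^{⌊L/2⌋} [I - (L+1-2q)^2 J] D_m P^{L+1} D_m⁻¹ - K_0 + K_{n-1}}`
with `m = L + 3 - (k mod 2)` and `n = ⌊(k+1)/2⌋`. -/
def detFactor (L k : ℕ) (y : ℝ) : ℝ :=
  let m := L + 3 - k % 2
  let n := (k + 1) / 2
  ((1 - (4 * y + ((L : ℝ) + 1) ^ 2) • J n) * shiftProd L n *
      (D m n * P n ^ (L + 1) * (D m n)⁻¹) - K 0 n + K (n - 1) n).det

/-- The right-hand side of the determinant formula, as a function of `r` (which stands for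
`√(4y+(L+1)^2)`) and of `y`. -/
def formula (L k : ℕ) (r y : ℝ) : ℝ :=
  (k.factorial : ℝ) / ((L + k + 1).factorial : ℝ) *
    (r ^ (L % 2 + (k + 1) % 2) / (2 ^ (k - 1) * (1 + ((L % 2 : ℕ) : ℝ)))) *
    (∏ q ∈ Finset.range (L / 2 + 1), (y + (q : ℝ) * ((L : ℝ) + 1 - (q : ℝ)))) *
    detFactor L k y

end Hypersum

end

/-!
Put `l = L + 1` and `r = 2N + l`. In the variable `r` the backward difference in `N` of the `L`-th
hypersum is a central difference: if `S_k^{(L)}(N) = G_l(2N + l)`, then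
`G_{l+1}(r + 1) - G_{l+1}(r - 1) = G_l(r)`, with `G_0(r) = (r / 2) ^ k`, and `G_l` vanishes at the
nodes `l, l - 2, …, -l`.

Such a sequence is written down at once. The coefficient `B_{l,e}` of `s ^ e` in
`(s / sinh s) ^ l * exp (r s)` has central difference `2 B_{l-1,e-1}` (`centralDiff_noerlund`),
since the central difference of `exp (r s)` is `2 sinh s * exp (r s)`. The central difference also
commutes with discarding the remainder modulo the monic polynomial with the nodes as its roots
(`centralDiff_vanishingPart`). Hence `G_l` is a multiple of `B_{l,k+l}` minus its remainder modulo
the node polynomial (`hypersum_eq_eval_hyperpoly`).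

That polynomial is explicit: the quotient of a power of `r` by the node polynomial is a complete
homogeneous symmetric polynomial, and as the nodes come in pairs `±(l - 2q)`, it is a coefficient of
`1 / ((1 - r² x) ∏ (1 - (l - 2q)² x))`, up to a factor `r` (`vanishingPart_nodePoly_X_pow`). So
`G_l(r)` is the product over the nodes, times a power of `r`, times one coefficient of the product
of `(s / sinh s) ^ l`, as a series in `x = s²`, with the factorially weighted series above
(`eval_vanishingPart_coeff`).

The determinant is that same coefficient. All its Toeplitz factors act on coefficient vectors as
multiplication by power series in `x`: `J` as `x`, and `P` as `sinh s / s`. Their product `M` with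
the diagonal weights is unit lower triangular, and the two unit tower matrices replace its last
column by the first unit vector `e₁`; by Cramer's rule the determinant is the last entry of
`M⁻¹ e₁` (`det_unitLower_sub_K_add_K`).
-/

noncomputable section

namespace Hypersum

section

open Polynomial

/-! ### Central differences and division by the node polynomial -/

/-- The monic polynomial of degree `l + 1` whose roots are the nodes `l, l - 2, …, -l`. In the
variable `r = 2N + l` these are the points `N = 0, -1, …, -l`. -/
def nodePoly (l : ℕ) : ℝ[X] :=
  ∏ q ∈ Finset.range (l + 1), (X - C ((l : ℝ) - 2 * (q : ℝ)))

/-- The map `f ↦ f - f %ₘ M = M * (f /ₘ M)`. For `M = nodePoly l` it subtracts from `f` its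
interpolation polynomial at the nodes; it is linear whether or not `M` is monic. -/
def vanishingPart (M : ℝ[X]) : ℝ[X] →ₗ[ℝ] ℝ[X] :=
  LinearMap.id - modByMonicHom M

/-- The central difference `f(X) ↦ f(X + 1) - f(X - 1)`. -/
def centralDiff : ℝ[X] →ₗ[ℝ] ℝ[X] := taylor (1 : ℝ) - taylor (-1 : ℝ)

lemma nodePoly_monic (l : ℕ) : (nodePoly l).Monic :=
  monic_prod_of_monic _ _ fun _ _ => monic_X_sub_C _

lemma degree_nodePoly (l : ℕ) : (nodePoly l).degree = ((l + 1 : ℕ) : WithBot ℕ) := by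
  rw [nodePoly, degree_prod]
  simp only [degree_X_sub_C, Finset.sum_const, Finset.card_range, nsmul_eq_mul, mul_one]

lemma vanishingPart_apply (M f : ℝ[X]) : vanishingPart M f = f - f %ₘ M := rfl

/-- Uniqueness of division with remainder, in terms of `vanishingPart`. -/
lemma vanishingPart_eq_mul {M f : ℝ[X]} (q : ℝ[X]) (hM : M.Monic)
    (h : (f - M * q).degree < M.degree) : vanishingPart M f = M * q := by
  have := (div_modByMonic_unique q (f - M * q) hM ⟨by ring, h⟩).2
  rw [vanishingPart_apply, this]; ring

lemma dvd_vanishingPart (M f : ℝ[X]) : M ∣ vanishingPart M f := by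
  rw [vanishingPart_apply]
  exact ⟨f /ₘ M, by linear_combination -modByMonic_add_div f M⟩

lemma vanishingPart_eq_zero {M f : ℝ[X]} (hM : M.Monic) (h : f.degree < M.degree) :
    vanishingPart M f = 0 := by
  rw [vanishingPart_apply, (modByMonic_eq_self_iff hM).2 h, sub_self]

lemma degree_centralDiff_lt (f : ℝ[X]) (d : ℕ) (h : f.degree < ((d + 1 : ℕ) : WithBot ℕ)) :
    (centralDiff f).degree < d := by
  rcases eq_or_ne f 0 with rfl | hf
  · rw [map_zero, degree_zero]; exact WithBot.bot_lt_coe d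
  have h1 : (centralDiff f).degree < f.degree := by
    rw [← degree_taylor f (1 : ℝ)]
    refine degree_sub_lt_left ?_ ?_ ?_
    · rw [degree_taylor, degree_taylor]
    · rwa [Ne, taylor_eq_zero]
    · simp
  rw [degree_eq_natDegree hf] at h h1
  have h2 : f.natDegree < d + 1 := by exact_mod_cast h
  exact lt_of_lt_of_le h1 (by exact_mod_cast Nat.lt_succ_iff.1 h2)

lemma nodePoly_dvd_taylor_one (l : ℕ) : nodePoly l ∣ taylor (1 : ℝ) (nodePoly (l + 1)) := by
  have : taylor (1 : ℝ) (nodePoly (l + 1)) =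
      ∏ q ∈ Finset.range (l + 2), (X - C ((l : ℝ) - 2 * (q : ℝ))) := by
    rw [nodePoly, taylor_apply, prod_comp]
    refine Finset.prod_congr rfl fun q _ => ?_
    rw [sub_comp, X_comp, C_comp, add_sub_assoc, ← C_sub, sub_eq_add_neg X, ← C_neg]
    congr 2
    push_cast
    ring
  rw [this, Finset.prod_range_succ]
  exact Dvd.intro _ rfl

lemma nodePoly_dvd_taylor_neg_one (l : ℕ) :
    nodePoly l ∣ taylor (-1 : ℝ) (nodePoly (l + 1)) := by
  have : taylor (-1 : ℝ) (nodePoly (l + 1)) =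
      ∏ q ∈ Finset.range (l + 2), (X - C ((l : ℝ) + 2 - 2 * (q : ℝ))) := by
    rw [nodePoly, taylor_apply, prod_comp]
    refine Finset.prod_congr rfl fun q _ => ?_
    rw [sub_comp, X_comp, C_comp, add_sub_assoc, ← C_sub, sub_eq_add_neg X, ← C_neg]
    congr 2
    push_cast
    ring
  rw [this, Finset.prod_range_succ', nodePoly]
  refine Dvd.intro (X - C ((l : ℝ) + 2 - 2 * ((0 : ℕ) : ℝ))) ?_
  congr 1
  refine Finset.prod_congr rfl fun q _ => ?_
  congr 2
  push_cast
  ring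

/-- The central difference carries the part vanishing at the `l + 2` nodes of `nodePoly (l + 1)`
to the part vanishing at the `l + 1` nodes of `nodePoly l`: the latter shifted by `±1` are among
the former, and the difference of a remainder of degree at most `l + 1` has degree at most `l`. -/
lemma centralDiff_vanishingPart (l : ℕ) (f : ℝ[X]) :
    centralDiff (vanishingPart (nodePoly (l + 1)) f) =
      vanishingPart (nodePoly l) (centralDiff f) := by
  have hdvd : nodePoly l ∣ centralDiff (vanishingPart (nodePoly (l + 1)) f) := by
    obtain ⟨q, hq⟩ := dvd_vanishingPart (nodePoly (l + 1)) f
    rw [hq, centralDiff, LinearMap.sub_apply, taylor_mul, taylor_mul]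
    exact dvd_sub ((nodePoly_dvd_taylor_one l).mul_right _)
      ((nodePoly_dvd_taylor_neg_one l).mul_right _)
  obtain ⟨q, hq⟩ := hdvd
  rw [hq]
  refine (vanishingPart_eq_mul q (nodePoly_monic l) ?_).symm
  rw [← hq, ← map_sub, vanishingPart_apply, sub_sub_cancel, degree_nodePoly]
  refine degree_centralDiff_lt _ _ ?_
  rw [← degree_nodePoly]
  exact degree_modByMonic_lt _ (nodePoly_monic _)

/-! ### Nörlund polynomials -/

/-- The series `∑ x^q / (2q+1)!`, that is `sinh s / s` in the variable `x = s²`. -/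
def sinhc : PowerSeries ℝ := PowerSeries.mk fun q => 1 / ((2 * q + 1).factorial : ℝ)

lemma constantCoeff_sinhc : PowerSeries.constantCoeff sinhc = 1 := by
  simp [sinhc, ← PowerSeries.coeff_zero_eq_constantCoeff_apply]

lemma sinhc_mul_inv : sinhc * sinhc⁻¹ = 1 :=
  PowerSeries.mul_inv_cancel _ (by rw [constantCoeff_sinhc]; exact one_ne_zero)

/-- A series `f(x)` read as the even series `f(s²)` with coefficients constant polynomials. -/
def constSeries (f : PowerSeries ℝ) : PowerSeries ℝ[X] :=
  PowerSeries.map C (PowerSeries.expand 2 two_ne_zero f)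

lemma constSeries_mul (f g : PowerSeries ℝ) :
    constSeries (f * g) = constSeries f * constSeries g := by
  simp [constSeries]

/-- The series `exp (X s)` in `s`, with coefficients `X ^ d / d!`. -/
def expSeries : PowerSeries ℝ[X] := PowerSeries.rescale X (PowerSeries.exp ℝ[X])

lemma coeff_expSeries (d : ℕ) :
    PowerSeries.coeff d expSeries = C (1 / (d.factorial : ℝ)) * X ^ d := by
  rw [expSeries, PowerSeries.coeff_rescale, PowerSeries.coeff_exp, mul_comm]
  congr 1
  rw [IsScalarTower.algebraMap_apply ℚ ℝ ℝ[X]]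
  simp [algebraMap_eq]

/-- The coefficient of `s ^ e` in `(s / sinh s) ^ l * exp (X s)`: up to normalization, a Bernoulli
polynomial of order `l` (a Nörlund polynomial), centred so that only powers of one parity occur.
-/
def noerlund (l e : ℕ) : ℝ[X] :=
  PowerSeries.coeff e (constSeries (sinhc⁻¹ ^ l) * expSeries)

lemma noerlund_zero (e : ℕ) : noerlund 0 e = C (1 / (e.factorial : ℝ)) * X ^ e := by
  simp [noerlund, constSeries, coeff_expSeries]

/-- The shift `X ↦ X + a` multiplies `exp (X s)` by `exp (a s)`. -/
lemma map_taylor_expSeries (a : ℝ) :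
    PowerSeries.map (taylorAlgHom a : ℝ[X] →+* ℝ[X]) expSeries =
      expSeries * PowerSeries.rescale (C a) (PowerSeries.exp ℝ[X]) := by
  rw [expSeries, PowerSeries.exp_mul_exp_eq_exp_add]
  ext1 d
  rw [PowerSeries.coeff_map, PowerSeries.coeff_rescale, PowerSeries.coeff_rescale,
    PowerSeries.coeff_exp, map_mul, map_pow, RingHom.map_rat_algebraMap]
  simp

/-- `exp s - exp (-s) = 2 s (sinh s / s)`. -/
lemma exp_sub_exp_neg :
    PowerSeries.rescale (C (1 : ℝ)) (PowerSeries.exp ℝ[X]) -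
      PowerSeries.rescale (C (-1 : ℝ)) (PowerSeries.exp ℝ[X]) =
      PowerSeries.X * PowerSeries.C (C 2) * constSeries sinhc := by
  ext1 d
  rw [map_sub, PowerSeries.coeff_rescale, PowerSeries.coeff_rescale, ← sub_mul, mul_assoc]
  rcases d with _ | d
  · simp
  rw [PowerSeries.coeff_succ_X_mul, PowerSeries.coeff_C_mul, constSeries, PowerSeries.coeff_map,
    PowerSeries.coeff_expand, PowerSeries.coeff_exp, IsScalarTower.algebraMap_apply ℚ ℝ ℝ[X],
    algebraMap_eq, ← C_pow, ← C_pow, ← C_sub, ← C_mul, ← C_mul]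
  congr 1
  split_ifs with h
  · obtain ⟨i, rfl⟩ := h
    rw [Nat.mul_div_cancel_left _ two_pos, sinhc, PowerSeries.coeff_mk, pow_succ (-1 : ℝ), pow_mul]
    norm_num
  · rw [(Nat.not_even_iff_odd.1 fun h' => h h'.two_dvd).add_one.neg_one_pow]
    simp

lemma centralDiff_coeff (f : PowerSeries ℝ) (e : ℕ) :
    centralDiff (PowerSeries.coeff e (constSeries f * expSeries)) =
      PowerSeries.coeff e (constSeries f * (expSeries *
        (PowerSeries.X * PowerSeries.C (C 2) * constSeries sinhc))) := by
  have key (a : ℝ) : taylor a (PowerSeries.coeff e (constSeries f * expSeries)) =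
      PowerSeries.coeff e (constSeries f *
        (expSeries * PowerSeries.rescale (C a) (PowerSeries.exp ℝ[X]))) := by
    rw [← map_taylor_expSeries]
    have h1 : constSeries f =
        PowerSeries.map (taylorAlgHom a : ℝ[X] →+* ℝ[X]) (constSeries f) := by
      rw [constSeries, PowerSeries.map_expand, PowerSeries.map_expand]
      congr 1
      ext1 d
      simp
    conv_rhs => rw [h1, ← map_mul, PowerSeries.coeff_map]
    rfl
  rw [← exp_sub_exp_neg, centralDiff, LinearMap.sub_apply, key, key, ← map_sub, mul_sub, mul_sub]

/-- The central difference multiplies the generating series by `2 sinh s`, which cancels one of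
the factors `s / sinh s` and leaves `2 s`. -/
lemma centralDiff_noerlund (l e : ℕ) :
    centralDiff (noerlund (l + 1) (e + 1)) = C 2 * noerlund l e := by
  have h : constSeries (sinhc⁻¹ ^ (l + 1)) * (expSeries *
        (PowerSeries.X * PowerSeries.C (C 2) * constSeries sinhc)) =
      PowerSeries.X * (PowerSeries.C (C 2) * (constSeries (sinhc⁻¹ ^ l) * expSeries)) := by
    have h2 : constSeries (sinhc⁻¹ ^ (l + 1)) * constSeries sinhc =
        constSeries (sinhc⁻¹ ^ l) := by
      rw [← constSeries_mul]
      congr 1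
      linear_combination sinhc⁻¹ ^ l * sinhc_mul_inv
    rw [← h2]; ring
  rw [noerlund, centralDiff_coeff, h, PowerSeries.coeff_succ_X_mul, PowerSeries.coeff_C_mul,
    noerlund]

/-! ### Hypersums as values of a polynomial -/

/-- The hypersum polynomial of order `L = l - 1` in the variable `r = 2N + l`. The index `l = 0`
stands for the power `N ^ k` that is summed first. -/
def hyperpoly (k l : ℕ) : ℝ[X] :=
  C ((k.factorial : ℝ) / 2 ^ (k + l)) * vanishingPart (nodePoly l) (noerlund l (k + l))

lemma vanishingPart_C_mul (M f : ℝ[X]) (c : ℝ) :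
    vanishingPart M (C c * f) = C c * vanishingPart M f := by
  rw [← smul_eq_C_mul, map_smul, smul_eq_C_mul]

lemma centralDiff_C_mul (f : ℝ[X]) (c : ℝ) : centralDiff (C c * f) = C c * centralDiff f := by
  rw [← smul_eq_C_mul, map_smul, smul_eq_C_mul]

lemma eval_centralDiff (f : ℝ[X]) (x : ℝ) :
    (centralDiff f).eval x = f.eval (x + 1) - f.eval (x - 1) := by
  simp [centralDiff, taylor_apply, sub_eq_add_neg]

lemma eval_hyperpoly_sub (k l : ℕ) (x : ℝ) :
    (hyperpoly k (l + 1)).eval (x + 1) - (hyperpoly k (l + 1)).eval (x - 1) =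
      (hyperpoly k l).eval x := by
  rw [← eval_centralDiff, hyperpoly, hyperpoly, centralDiff_C_mul, centralDiff_vanishingPart,
    ← add_assoc, centralDiff_noerlund, vanishingPart_C_mul]
  simp only [eval_mul, eval_C, pow_succ]
  field_simp

/-- Here `k > 0` is needed: `r ^ k` has to vanish at the only node `0`. -/
lemma eval_hyperpoly_zero {k : ℕ} (hk : 0 < k) (x : ℝ) :
    (hyperpoly k 0).eval (2 * x) = x ^ k := by
  have h : vanishingPart (nodePoly 0) (X ^ k) = X ^ k := by
    rw [vanishingPart_apply, (modByMonic_eq_zero_iff_dvd (nodePoly_monic 0)).2, sub_zero]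
    simpa [nodePoly] using (dvd_pow_self (X : ℝ[X]) hk.ne')
  rw [hyperpoly, add_zero, noerlund_zero, vanishingPart_C_mul, h]
  have := Nat.factorial_ne_zero k
  simp [mul_pow]
  field_simp

lemma eval_hyperpoly_self (k l : ℕ) : (hyperpoly k l).eval (l : ℝ) = 0 := by
  obtain ⟨q, hq⟩ := dvd_vanishingPart (nodePoly l) (noerlund l (k + l))
  rw [hyperpoly, hq, eval_mul, eval_mul, nodePoly, eval_prod,
    Finset.prod_eq_zero (i := 0) (by simp) (by simp)]
  simp

lemma sum_eval_hyperpoly (k l N : ℕ) :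
    ∑ n ∈ Finset.Icc 1 N, (hyperpoly k l).eval (2 * (n : ℝ) + l) =
      (hyperpoly k (l + 1)).eval (2 * (N : ℝ) + (l + 1 : ℕ)) := by
  induction N with
  | zero =>
    have := eval_hyperpoly_self k (l + 1)
    simpa using this.symm
  | succ N ih =>
    rw [Finset.sum_Icc_succ_top (by omega), ih, ← eval_hyperpoly_sub k l]
    have h1 : 2 * ((N + 1 : ℕ) : ℝ) + l + 1 = 2 * ((N + 1 : ℕ) : ℝ) + (l + 1 : ℕ) := by
      push_cast; ring
    have h2 : 2 * ((N + 1 : ℕ) : ℝ) + l - 1 = 2 * (N : ℝ) + (l + 1 : ℕ) := by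
      push_cast; ring
    rw [h1, h2, add_sub_cancel]

lemma hypersum_eq_eval_hyperpoly {k : ℕ} (hk : 0 < k) (L N : ℕ) :
    (hypersum k L N : ℝ) = (hyperpoly k (L + 1)).eval (2 * (N : ℝ) + (L + 1 : ℕ)) := by
  induction L generalizing N with
  | zero =>
    rw [← sum_eval_hyperpoly, hypersum]
    push_cast
    exact Finset.sum_congr rfl fun n _ => by rw [add_zero, eval_hyperpoly_zero hk]
  | succ L ih =>
    rw [← sum_eval_hyperpoly, hypersum]
    push_cast
    exact Finset.sum_congr rfl fun n _ => by rw [ih]; push_cast; rfl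

/-! ### Division of powers by a product of linear factors -/

/-- The polynomial `∑ i ≤ j, g i * X ^ (j - i)`, in Horner form. -/
def hornerPoly (g : ℕ → ℝ) : ℕ → ℝ[X]
  | 0 => C (g 0)
  | j + 1 => X * hornerPoly g j + C (g (j + 1))

/-- The monic polynomial with roots `a 0, …, a (n - 1)`. -/
def rootProd (a : ℕ → ℝ) (n : ℕ) : ℝ[X] := ∏ q ∈ Finset.range n, (X - C (a q))

/-- The reverse `∏ (1 - a q x)` of `rootProd a n`, as a power series. -/
def revProd (a : ℕ → ℝ) (n : ℕ) : PowerSeries ℝ :=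
  ∏ q ∈ Finset.range n, (1 - PowerSeries.C (a q) * PowerSeries.X)

lemma constantCoeff_one_sub (a : ℝ) :
    PowerSeries.constantCoeff (1 - PowerSeries.C a * PowerSeries.X) = 1 := by simp

lemma constantCoeff_revProd (a : ℕ → ℝ) (n : ℕ) :
    PowerSeries.constantCoeff (revProd a n) = 1 := by
  simp [revProd, map_prod]

/-- The values at `X` and at `a` of the polynomial for `(1 - a x) g` differ by `X - a` times the
polynomial for `g`. -/
lemma hornerPoly_one_sub_mul (a : ℝ) (g : PowerSeries ℝ) (j : ℕ) :
    hornerPoly (fun i => PowerSeries.coeff i ((1 - PowerSeries.C a * PowerSeries.X) * g)) (j + 1) =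
      (X - C a) * hornerPoly (fun i => PowerSeries.coeff i g) j +
        C (PowerSeries.coeff (j + 1) g) := by
  have h (i : ℕ) : PowerSeries.coeff (i + 1) ((1 - PowerSeries.C a * PowerSeries.X) * g) =
      PowerSeries.coeff (i + 1) g - a * PowerSeries.coeff i g := by
    rw [sub_mul, one_mul, mul_assoc, map_sub, PowerSeries.coeff_C_mul,
      PowerSeries.coeff_succ_X_mul]
  induction j with
  | zero =>
    simp only [hornerPoly]
    rw [h]
    simp
    ring
  | succ j ih =>
    rw [hornerPoly, ih, h, hornerPoly]
    simp only [C_sub, C_mul]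
    ring

lemma degree_rootProd (a : ℕ → ℝ) (n : ℕ) : (rootProd a n).degree = n := by
  rw [rootProd, degree_prod]
  simp only [degree_X_sub_C, Finset.sum_const, Finset.card_range, nsmul_eq_mul, mul_one]

/-- The quotient of `X ^ (j + n)` by `rootProd a n` is the complete homogeneous symmetric
polynomial of degree `j` in `X` and the roots: the coefficient of `x ^ j` in
`1 / ((1 - X x) ∏ (1 - a q x))`. -/
lemma degree_X_pow_sub_rootProd_mul (a : ℕ → ℝ) (n : ℕ) (g : PowerSeries ℝ)
    (hg : revProd a n * g = 1) (j : ℕ) :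
    (X ^ (j + n) - rootProd a n * hornerPoly (fun i => PowerSeries.coeff i g) j).degree <
      (n : WithBot ℕ) := by
  induction n generalizing g j with
  | zero =>
    have hg1 : g = 1 := by simpa [revProd] using hg
    have h (j : ℕ) : hornerPoly (fun i => PowerSeries.coeff i g) j = X ^ j := by
      induction j with
      | zero => simp [hornerPoly, hg1]
      | succ j ih =>
        rw [hornerPoly, ih, hg1, PowerSeries.coeff_one]
        simp [pow_succ']
    rw [h]
    simp [rootProd]
  | succ n ih =>
    have h1 := ih ((1 - PowerSeries.C (a n) * PowerSeries.X) * g)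
      (by rw [← mul_assoc, revProd, ← Finset.prod_range_succ]; exact hg) (j + 1)
    rw [hornerPoly_one_sub_mul] at h1
    have h2 : X ^ (j + (n + 1)) -
        rootProd a (n + 1) * hornerPoly (fun i => PowerSeries.coeff i g) j =
        (X ^ (j + 1 + n) - rootProd a n *
          ((X - C (a n)) * hornerPoly (fun i => PowerSeries.coeff i g) j +
            C (PowerSeries.coeff (j + 1) g))) +
          C (PowerSeries.coeff (j + 1) g) * rootProd a n := by
      rw [rootProd, rootProd, Finset.prod_range_succ]
      ring
    rw [h2]
    refine (degree_add_le _ _).trans_lt (max_lt (h1.trans ?_) ?_)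
    · exact_mod_cast Nat.lt_succ_self n
    · rw [← smul_eq_C_mul]
      refine (degree_smul_le _ _).trans_lt ?_
      rw [degree_rootProd]
      exact_mod_cast Nat.lt_succ_self n

/-! ### The node polynomial and its parity -/

/-- The square of the node `l - 2q`. -/
def nodeSq (l q : ℕ) : ℝ := ((l : ℝ) - 2 * (q : ℝ)) ^ 2

/-- The nodes come in pairs `±(l - 2q)`, with the node `0` left over when `l` is even. -/
lemma nodePoly_eq (l : ℕ) :
    nodePoly l = X ^ ((l + 1) % 2) * (rootProd (nodeSq l) ((l + 1) / 2)).comp (X ^ 2) := by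
  induction l using Nat.twoStepInduction with
  | zero => simp [nodePoly, rootProd]
  | one =>
    simp [nodePoly, rootProd, nodeSq, Finset.prod_range_succ]
    have : (C 2 : ℝ[X]) = 2 := rfl
    rw [this]
    ring
  | more l ih _ =>
    have h1 : nodePoly (l + 2) = (X ^ 2 - C (((l : ℝ) + 2) ^ 2)) * nodePoly l := by
      rw [nodePoly, Finset.prod_range_succ, Finset.prod_range_succ', nodePoly]
      have : ∀ q ∈ Finset.range (l + 1), (X : ℝ[X]) - C (((l + 2 : ℕ) : ℝ) - 2 * ((q + 1 : ℕ) : ℝ))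
          = X - C ((l : ℝ) - 2 * (q : ℝ)) := fun q _ => by
        congr 2; push_cast; ring
      rw [Finset.prod_congr rfl this]
      push_cast
      have h2 : (l : ℝ) + 2 - 2 * (l + 2) = -(l + 2) := by ring
      rw [h2]
      simp only [mul_zero, sub_zero, C_neg, C_pow]
      ring
    have h3 : (l + 2 + 1) / 2 = (l + 1) / 2 + 1 := by omega
    have h4 : (l + 2 + 1) % 2 = (l + 1) % 2 := by omega
    have h5 : rootProd (nodeSq (l + 2)) ((l + 1) / 2 + 1) =
        (X - C (((l : ℝ) + 2) ^ 2)) * rootProd (nodeSq l) ((l + 1) / 2) := by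
      rw [rootProd, Finset.prod_range_succ', mul_comm, rootProd]
      congr 1
      · simp [nodeSq]
      · refine Finset.prod_congr rfl fun q _ => ?_
        congr 2
        simp only [nodeSq]
        push_cast
        ring
    rw [h1, ih, h3, h4, h5]
    simp only [mul_comp, sub_comp, X_comp, C_comp]
    ring

lemma degree_comp_X_sq_lt (f : ℝ[X]) (n c m : ℕ) (hm : 2 * n + c ≤ m + 1)
    (h : f.degree < (n : WithBot ℕ)) :
    (X ^ c * f.comp (X ^ 2)).degree < (m : WithBot ℕ) := by
  rcases eq_or_ne f 0 with rfl | hf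
  · simp
  have h1 : f.natDegree < n := (natDegree_lt_iff_degree_lt hf).2 h
  refine degree_le_natDegree.trans_lt ?_
  have h2 : (X ^ c * f.comp (X ^ 2)).natDegree ≤ c + f.natDegree * 2 := by
    refine natDegree_mul_le.trans ?_
    rw [natDegree_comp, natDegree_X_pow, natDegree_X_pow]
  exact_mod_cast (by omega : (X ^ c * f.comp (X ^ 2)).natDegree < m)

/-- Powers `X ^ d` with `d ≥ l + 1`, according to the parity `b` of `d - (l + 1)`. -/
lemma vanishingPart_nodePoly_X_pow (l : ℕ) (g : PowerSeries ℝ)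
    (hg : revProd (nodeSq l) ((l + 1) / 2) * g = 1) (j b : ℕ) (hb : b ≤ 1) :
    vanishingPart (nodePoly l) (X ^ (l + 1 + b + 2 * j)) =
      nodePoly l * (X ^ b * (hornerPoly (fun i => PowerSeries.coeff i g) j).comp (X ^ 2)) := by
  refine vanishingPart_eq_mul _ (nodePoly_monic l) ?_
  have h := degree_comp_X_sq_lt _ _ ((l + 1) % 2 + b)
    (l + 1) (by omega)
    (degree_X_pow_sub_rootProd_mul (nodeSq l) ((l + 1) / 2) g hg j)
  have h1 : l + 1 + b + 2 * j = (l + 1) % 2 + b + 2 * (j + (l + 1) / 2) := by omega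
  have h2 : X ^ (l + 1 + b + 2 * j) - nodePoly l *
      (X ^ b * (hornerPoly (fun i => PowerSeries.coeff i g) j).comp (X ^ 2)) =
      X ^ ((l + 1) % 2 + b) * (X ^ (j + (l + 1) / 2) - rootProd (nodeSq l) ((l + 1) / 2) *
        hornerPoly (fun i => PowerSeries.coeff i g) j).comp (X ^ 2) := by
    rw [h1, nodePoly_eq]
    simp only [sub_comp, mul_comp, pow_comp, X_comp]
    ring
  rwa [h2, degree_nodePoly]

/-- Evaluation at `z` amounts to one more factor `1 / (1 - z x)` in the generating series. -/
lemma eval_hornerPoly (g : PowerSeries ℝ) (z : ℝ) (j : ℕ) :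
    (hornerPoly (fun i => PowerSeries.coeff i g) j).eval z =
      PowerSeries.coeff j ((1 - PowerSeries.C z * PowerSeries.X)⁻¹ * g) := by
  set h := (1 - PowerSeries.C z * PowerSeries.X)⁻¹ * g with hh
  have hg : (1 - PowerSeries.C z * PowerSeries.X) * h = g := by
    rw [hh, ← mul_assoc, PowerSeries.mul_inv_cancel _ (by simp), one_mul]
  have hrec (i : ℕ) : PowerSeries.coeff (i + 1) g =
      PowerSeries.coeff (i + 1) h - z * PowerSeries.coeff i h := by
    rw [← hg, sub_mul, one_mul, mul_assoc, map_sub, PowerSeries.coeff_C_mul,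
      PowerSeries.coeff_succ_X_mul]
  induction j with
  | zero => rw [← hg]; simp [hornerPoly]
  | succ j ih =>
    rw [hornerPoly, hrec]
    simp only [eval_add, eval_mul, eval_X, eval_C, ih]
    ring

lemma eval_nodePoly (l : ℕ) (x : ℝ) :
    (nodePoly l).eval (2 * x + l) = 2 ^ (l + 1) * ∏ j ∈ Finset.range (l + 1), (x + (j : ℝ)) := by
  have h : (2 : ℝ) ^ (l + 1) = ∏ _j ∈ Finset.range (l + 1), 2 := by simp
  rw [nodePoly, eval_prod, h, ← Finset.prod_mul_distrib]
  refine Finset.prod_congr rfl fun q _ => ?_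
  simp only [eval_sub, eval_X, eval_C]
  ring

lemma eval_nodePoly_eq_prod (l : ℕ) (x : ℝ) :
    (nodePoly l).eval (2 * x + l) = (2 * x + l) ^ ((l + 1) % 2) *
      (4 ^ ((l + 1) / 2) *
        ∏ q ∈ Finset.range ((l + 1) / 2), (x * (x + l) + (q : ℝ) * ((l : ℝ) - (q : ℝ)))) := by
  have h : (4 : ℝ) ^ ((l + 1) / 2) = ∏ _j ∈ Finset.range ((l + 1) / 2), 4 := by simp
  rw [nodePoly_eq, h, ← Finset.prod_mul_distrib, rootProd, eval_mul, eval_comp, eval_prod,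
    eval_pow, eval_pow, eval_X]
  congr 1
  refine Finset.prod_congr rfl fun q _ => ?_
  simp only [eval_sub, eval_X, eval_C, nodeSq]
  ring

end

section

open PowerSeries

/-! ### Toeplitz matrices acting on coefficient vectors -/

/-- The first `n` coefficients of a power series. Lower-triangular Toeplitz matrices act on these
vectors as multiplication by power series. -/
def coeffVec (n : ℕ) (f : PowerSeries ℝ) : Fin n → ℝ := fun i => coeff (i : ℕ) f

lemma coeffVec_sub (n : ℕ) (f g : PowerSeries ℝ) :
    coeffVec n (f - g) = coeffVec n f - coeffVec n g := by
  ext i; simp [coeffVec]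

lemma coeffVec_C_mul (n : ℕ) (a : ℝ) (f : PowerSeries ℝ) :
    coeffVec n (C a * f) = a • coeffVec n f := by
  ext i; simp [coeffVec]

lemma J_mulVec_coeffVec (n : ℕ) (f : PowerSeries ℝ) :
    (J n).mulVec (coeffVec n f) = coeffVec n (X * f) := by
  ext ⟨i, hi⟩
  simp only [Matrix.mulVec, dotProduct, J, Matrix.of_apply, coeffVec]
  rcases i with _ | i
  · simp
  · rw [coeff_succ_X_mul, Finset.sum_eq_single ⟨i, by omega⟩]
    · simp
    · rintro ⟨j, hj⟩ _ hne
      rw [if_neg, zero_mul]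
      simp only [ne_eq, Fin.mk.injEq] at hne
      simp only
      omega
    · simp

lemma one_sub_smul_J_mulVec_coeffVec (n : ℕ) (a : ℝ) (f : PowerSeries ℝ) :
    (1 - a • J n).mulVec (coeffVec n f) = coeffVec n ((1 - C a * X) * f) := by
  rw [Matrix.sub_mulVec, Matrix.one_mulVec, Matrix.smul_mulVec, J_mulVec_coeffVec, sub_mul,
    one_mul, coeffVec_sub, mul_assoc, coeffVec_C_mul]

lemma P_mulVec_coeffVec (n : ℕ) (f : PowerSeries ℝ) :
    (P n).mulVec (coeffVec n f) = coeffVec n (sinhc * f) := by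
  ext ⟨i, hi⟩
  simp only [Matrix.mulVec, dotProduct, P, Matrix.of_apply, coeffVec]
  rw [mul_comm, coeff_mul, Finset.Nat.sum_antidiagonal_eq_sum_range_succ_mk,
    Finset.sum_fin_eq_sum_range]
  symm
  refine Finset.sum_subset_zero_on_sdiff (Finset.range_subset_range.2 hi) ?_ ?_
  · intro j hj
    simp only [Finset.mem_sdiff, Finset.mem_range, not_lt] at hj
    rw [dif_pos hj.1, if_neg, zero_mul]
    simp only [Fin.mk_le_mk]
    omega
  · intro j hj
    have hj' := Finset.mem_range.1 hj
    rw [dif_pos (by omega), if_pos (by simp only [Fin.mk_le_mk]; omega), mul_comm]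
    simp [sinhc]

lemma P_pow_mulVec_coeffVec (n l : ℕ) (f : PowerSeries ℝ) :
    (P n ^ l).mulVec (coeffVec n f) = coeffVec n (sinhc ^ l * f) := by
  induction l generalizing f with
  | zero => simp
  | succ l ih =>
    rw [pow_succ, ← Matrix.mulVec_mulVec, P_mulVec_coeffVec, ih, pow_succ, mul_assoc]

lemma D_mulVec_coeffVec (m n : ℕ) (f : PowerSeries ℝ) :
    (D m n).mulVec (coeffVec n f) =
      coeffVec n (mk fun i => ((m + 2 * i).factorial : ℝ) * coeff i f) := by
  ext i
  simp [D, Matrix.mulVec_diagonal, coeffVec]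

lemma isUnit_det_D (m n : ℕ) : IsUnit (D m n).det := by
  rw [D, Matrix.det_diagonal, isUnit_iff_ne_zero]
  exact Finset.prod_ne_zero_iff.2 fun i _ => by positivity

lemma D_inv_mulVec_coeffVec (m n : ℕ) (f : PowerSeries ℝ) :
    ((D m n)⁻¹).mulVec (coeffVec n f) =
      coeffVec n (mk fun i => coeff i f / ((m + 2 * i).factorial : ℝ)) := by
  have h : coeffVec n f =
      (D m n).mulVec (coeffVec n (mk fun i => coeff i f / ((m + 2 * i).factorial : ℝ))) := by
    rw [D_mulVec_coeffVec]
    ext i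
    simp only [coeffVec, coeff_mk]
    field_simp
  conv_lhs => rw [h]
  rw [Matrix.mulVec_mulVec, Matrix.nonsing_inv_mul _ (isUnit_det_D m n), Matrix.one_mulVec]

lemma shiftProd_mulVec_coeffVec (L n : ℕ) (f : PowerSeries ℝ) :
    (shiftProd L n).mulVec (coeffVec n f) =
      coeffVec n (revProd (nodeSq (L + 1)) (L / 2 + 1) * f) := by
  rw [shiftProd]
  generalize L / 2 + 1 = t
  induction t generalizing f with
  | zero => simp [revProd]
  | succ t ih =>
    rw [List.range_succ, List.map_append, List.prod_append, List.map_singleton,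
      List.prod_singleton, ← Matrix.mulVec_mulVec, one_sub_smul_J_mulVec_coeffVec, ih, revProd,
      revProd, Finset.prod_range_succ, mul_assoc, nodeSq]
    push_cast
    rfl

lemma det_one_sub_smul_J (n : ℕ) (a : ℝ) : (1 - a • J n).det = 1 := by
  rw [Matrix.det_of_isLowerTriangular]
  · simp [J]
  · intro i j hij
    have hij' : i < j := hij
    have h : (i : ℕ) < j := hij'
    simp only [Matrix.sub_apply, Matrix.one_apply_ne hij'.ne, Matrix.smul_apply, J,
      Matrix.of_apply, if_neg (show ¬ (i : ℕ) = j + 1 by omega), smul_zero, sub_zero]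

lemma det_P (n : ℕ) : (P n).det = 1 := by
  rw [Matrix.det_of_isLowerTriangular]
  · simp [P]
  · intro i j hij
    have hij' : i < j := hij
    simp [P, hij'.not_ge]

lemma det_shiftProd (L n : ℕ) : (shiftProd L n).det = 1 := by
  rw [shiftProd, ← Matrix.coe_detMonoidHom, map_list_prod]
  refine List.prod_eq_one fun x hx => ?_
  simp only [List.mem_map] at hx
  obtain ⟨_, ⟨q, _, rfl⟩, rfl⟩ := hx
  exact det_one_sub_smul_J _ _

/-! ### The determinant -/

/-- The unit lower-triangular matrix from which the determinant is built by altering the last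
column; `z` stands for `4y + (L+1)²`. -/
def unitLower (L m n : ℕ) (z : ℝ) : Matrix (Fin n) (Fin n) ℝ :=
  (1 - z • J n) * shiftProd L n * (D m n * P n ^ (L + 1) * (D m n)⁻¹)

lemma det_unitLower (L m n : ℕ) (z : ℝ) : (unitLower L m n z).det = 1 := by
  rw [unitLower, Matrix.det_mul, Matrix.det_mul, det_one_sub_smul_J, det_shiftProd,
    Matrix.det_mul, Matrix.det_mul, Matrix.det_pow, det_P, one_pow, mul_one, mul_one, one_mul,
    ← Matrix.det_mul, Matrix.mul_nonsing_inv _ (isUnit_det_D m n), Matrix.det_one]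

lemma unitLower_mulVec_coeffVec (L m n : ℕ) (z : ℝ) (f : PowerSeries ℝ) :
    (unitLower L m n z).mulVec (coeffVec n f) =
      coeffVec n ((1 - C z * X) * (revProd (nodeSq (L + 1)) (L / 2 + 1) *
        mk fun i => ((m + 2 * i).factorial : ℝ) * coeff i (sinhc ^ (L + 1) *
          mk fun i => coeff i f / ((m + 2 * i).factorial : ℝ)))) := by
  rw [unitLower, ← Matrix.mulVec_mulVec, ← Matrix.mulVec_mulVec, ← Matrix.mulVec_mulVec,
    ← Matrix.mulVec_mulVec, D_inv_mulVec_coeffVec, P_pow_mulVec_coeffVec, D_mulVec_coeffVec,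
    shiftProd_mulVec_coeffVec, one_sub_smul_J_mulVec_coeffVec]

lemma coeffVec_X_pow (t : ℕ) : coeffVec (t + 1) (X ^ t) = Pi.single (Fin.last t) 1 := by
  ext i
  rcases eq_or_ne i (Fin.last t) with rfl | h
  · simp [coeffVec]
  · rw [Pi.single_eq_of_ne h, coeffVec, coeff_X_pow, if_neg]
    exact fun h' => h (Fin.ext h')

lemma coeffVec_mul_X_pow (t : ℕ) (f : PowerSeries ℝ) :
    coeffVec (t + 1) (f * X ^ t) = coeffVec (t + 1) (C (constantCoeff f) * X ^ t) := by
  ext ⟨i, hi⟩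
  rw [coeffVec, coeffVec]
  simp only
  rw [coeff_mul_X_pow', coeff_C_mul, coeff_X_pow]
  rcases Nat.lt_succ_iff_lt_or_eq.1 hi with h | rfl
  · simp [h.not_ge, h.ne]
  · simp

lemma unitLower_mulVec_single_last (L m t : ℕ) (z : ℝ) :
    (unitLower L m (t + 1) z).mulVec (Pi.single (Fin.last t) 1) = Pi.single (Fin.last t) 1 := by
  have hdiv : (mk fun i => coeff i ((X : PowerSeries ℝ) ^ t) / ((m + 2 * i).factorial : ℝ)) =
      C (1 / ((m + 2 * t).factorial : ℝ)) * X ^ t := by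
    ext i
    rw [coeff_mk, coeff_C_mul, coeff_X_pow]
    split_ifs with h <;> simp [h]
  -- every factor maps series divisible by `X ^ t` to such series, and only the leading
  -- coefficient survives the truncation to `t + 1` coefficients
  obtain ⟨u, hu⟩ : X ^ t ∣ mk fun i => ((m + 2 * i).factorial : ℝ) *
      coeff i (sinhc ^ (L + 1) * (C (1 / ((m + 2 * t).factorial : ℝ)) * X ^ t)) := by
    rw [X_pow_dvd_iff]
    intro i hi
    rw [coeff_mk, ← mul_assoc, coeff_mul_X_pow', if_neg hi.not_ge, mul_zero]
  have hu0 : constantCoeff u = 1 := by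
    have h := congrArg (coeff t) hu
    rw [coeff_mk, ← mul_assoc, coeff_mul_X_pow', coeff_X_pow_mul', if_pos le_rfl, if_pos le_rfl,
      Nat.sub_self, coeff_zero_eq_constantCoeff_apply, coeff_zero_eq_constantCoeff_apply,
      map_mul, map_pow, constantCoeff_sinhc, constantCoeff_C, one_pow, one_mul] at h
    rw [← h]
    field_simp
  rw [← coeffVec_X_pow, unitLower_mulVec_coeffVec, hdiv, hu, mul_comm _ u, ← mul_assoc,
    ← mul_assoc, coeffVec_mul_X_pow, map_mul constantCoeff, map_mul constantCoeff,
    constantCoeff_one_sub, constantCoeff_revProd, hu0]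
  simp

/-- Subtracting `K_0` and adding `K_{n-1}` replaces the last column, a unit vector, by the first
unit vector, which is the coefficient vector of `1`. -/
lemma sub_K_add_K_eq_updateCol (t : ℕ) (M : Matrix (Fin (t + 1)) (Fin (t + 1)) ℝ)
    (hM : M.mulVec (Pi.single (Fin.last t) 1) = Pi.single (Fin.last t) 1) :
    M - K 0 (t + 1) + K t (t + 1) = M.updateCol (Fin.last t) (coeffVec (t + 1) 1) := by
  ext i j
  rcases eq_or_ne j (Fin.last t) with rfl | hj
  · have h : M i (Fin.last t) = if (i : ℕ) = t then 1 else 0 := by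
      have := congrFun hM i
      rw [Matrix.mulVec_single_one, Pi.single_apply] at this
      simpa [Matrix.col, Fin.ext_iff] using this
    rw [Matrix.updateCol_self, Matrix.add_apply, Matrix.sub_apply, h]
    simp [K, coeffVec, coeff_one, Nat.add_right_comm _ 1 t]
  · have h : (j : ℕ) ≠ t := fun h => hj (Fin.ext h)
    rw [Matrix.updateCol_ne hj]
    simp [K, h]

/-- Cramer's rule for a matrix of determinant one. -/
lemma det_updateCol_of_mulVec_eq {n : Type*} [Fintype n] [DecidableEq n] (M : Matrix n n ℝ)
    (hM : M.det = 1) {v b : n → ℝ} (h : M.mulVec v = b) (i : n) :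
    (M.updateCol i b).det = v i := by
  rw [← Matrix.cramer_apply, Matrix.cramer_eq_adjugate_mulVec, ← h, Matrix.mulVec_mulVec,
    Matrix.adjugate_mul, hM, one_smul, Matrix.one_mulVec]

/-- By Cramer's rule the determinant is the last entry of the solution `v` of
`unitLower L m n z * v = e₁`, which is obtained by inverting the factors of the matrix as power series. -/
lemma det_unitLower_sub_K_add_K (L m t : ℕ) (z : ℝ) {h : PowerSeries ℝ}
    (hh : (1 - C z * X) * (revProd (nodeSq (L + 1)) (L / 2 + 1) * h) = 1) :
    (unitLower L m (t + 1) z - K 0 (t + 1) + K t (t + 1)).det =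
      ((m + 2 * t).factorial : ℝ) *
        coeff t (sinhc⁻¹ ^ (L + 1) * mk fun j => coeff j h / ((m + 2 * j).factorial : ℝ)) := by
  rw [sub_K_add_K_eq_updateCol _ _ (unitLower_mulVec_single_last L m t z),
    det_updateCol_of_mulVec_eq _ (det_unitLower L m (t + 1) z) (v := coeffVec (t + 1)
      (mk fun i => ((m + 2 * i).factorial : ℝ) * coeff i (sinhc⁻¹ ^ (L + 1) *
        mk fun j => coeff j h / ((m + 2 * j).factorial : ℝ))))]
  · simp [coeffVec]
  · have hne (i : ℕ) : ((m + 2 * i).factorial : ℝ) ≠ 0 := by positivity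
    rw [unitLower_mulVec_coeffVec, ← hh]
    simp only [coeff_mk, mul_div_cancel_left₀ _ (hne _)]
    -- the factors `sinhc` and `sinhc⁻¹` cancel once the diagonal weights are removed
    congr 3
    ext i
    rw [coeff_mk, show (mk fun i => coeff i (sinhc⁻¹ ^ (L + 1) *
      mk fun j => coeff j h / ((m + 2 * j).factorial : ℝ))) = sinhc⁻¹ ^ (L + 1) *
        mk fun j => coeff j h / ((m + 2 * j).factorial : ℝ) from ext fun i => coeff_mk _ _,
      ← mul_assoc, ← mul_pow, sinhc_mul_inv, one_pow, one_mul, coeff_mk,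
      mul_div_cancel₀ _ (hne i)]

end

section

open Polynomial

/-! ### Comparison of the two coefficient formulas -/

lemma vanishingPart_coeff_mul_expSeries (l b t : ℕ) (hb : b ≤ 1) (f g : PowerSeries ℝ)
    (hg : revProd (nodeSq l) ((l + 1) / 2) * g = 1) :
    vanishingPart (nodePoly l)
        (PowerSeries.coeff (l + 1 + b + 2 * t) (constSeries f * expSeries)) =
      ∑ p ∈ Finset.HasAntidiagonal.antidiagonal t,
        C (PowerSeries.coeff p.1 f * (1 / ((l + 1 + b + 2 * p.2).factorial : ℝ))) *
          (nodePoly l * (X ^ b *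
            (hornerPoly (fun i => PowerSeries.coeff i g) p.2).comp (X ^ 2))) := by
  rw [PowerSeries.coeff_mul, map_sum]
  symm
  -- the remaining terms vanish: odd coefficients of the even series are zero, and the powers
  -- `X ^ d` with `d ≤ l` equal their own remainder
  refine Finset.sum_of_injOn (fun p => (2 * p.1, l + 1 + b + 2 * p.2)) ?_ ?_ ?_ ?_
  · rintro ⟨i, j⟩ _ ⟨i', j'⟩ _ h
    simp only [Prod.mk.injEq] at h ⊢
    omega
  · rintro ⟨i, j⟩ h
    simp only [Finset.mem_coe, Finset.HasAntidiagonal.mem_antidiagonal] at h ⊢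
    omega
  · rintro ⟨i, j⟩ h hne
    rw [Finset.HasAntidiagonal.mem_antidiagonal] at h
    simp only at h ⊢
    rw [constSeries, PowerSeries.coeff_map, PowerSeries.coeff_expand, coeff_expSeries,
      vanishingPart_C_mul, vanishingPart_C_mul]
    split_ifs with hi
    · obtain ⟨i, rfl⟩ := hi
      rw [vanishingPart_eq_zero (nodePoly_monic l), mul_zero, mul_zero]
      rw [degree_X_pow, degree_nodePoly]
      by_contra hlt
      have hlt' : l + 1 ≤ j := by
        rw [not_lt] at hlt
        exact_mod_cast hlt
      exact hne ⟨(i, t - i), by simp; omega, by simp; omega⟩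
    · simp
  · rintro ⟨i, j⟩ h
    simp only
    rw [constSeries, PowerSeries.coeff_map, PowerSeries.coeff_expand_mul, coeff_expSeries,
      vanishingPart_C_mul, vanishingPart_C_mul, vanishingPart_nodePoly_X_pow l g hg j b hb, C_mul,
      mul_assoc]

lemma eval_vanishingPart_coeff (l b t : ℕ) (hb : b ≤ 1) (f g : PowerSeries ℝ)
    (hg : revProd (nodeSq l) ((l + 1) / 2) * g = 1) (r : ℝ) :
    (vanishingPart (nodePoly l)
        (PowerSeries.coeff (l + 1 + b + 2 * t) (constSeries f * expSeries))).eval r =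
      (nodePoly l).eval r * r ^ b * PowerSeries.coeff t (f * PowerSeries.mk fun j =>
        PowerSeries.coeff j ((1 - PowerSeries.C (r ^ 2) * PowerSeries.X)⁻¹ * g) /
          ((l + 1 + b + 2 * j).factorial : ℝ)) := by
  rw [vanishingPart_coeff_mul_expSeries l b t hb f g hg, eval_finsetSum, PowerSeries.coeff_mul,
    Finset.mul_sum]
  refine Finset.sum_congr rfl fun p _ => ?_
  rw [PowerSeries.coeff_mk]
  simp only [eval_mul, eval_C, eval_pow, eval_X, eval_comp, eval_hornerPoly]
  ring

lemma four_pow_mul_two_pow (l : ℕ) :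
    (4 : ℝ) ^ ((l + 1) / 2) * (1 + (((l + 1) % 2 : ℕ) : ℝ)) = 2 ^ (l + 1) := by
  have h1 : (1 + (((l + 1) % 2 : ℕ) : ℝ)) = 2 ^ ((l + 1) % 2) := by
    rcases Nat.mod_two_eq_zero_or_one (l + 1) with h | h <;> rw [h] <;> norm_num
  rw [h1, show (4 : ℝ) = 2 ^ 2 by norm_num, ← pow_mul, ← pow_add, Nat.div_add_mod]

lemma eval_hyperpoly_eq_formula (L k : ℕ) (hk : 0 < k) (x : ℝ) :
    (hyperpoly k (L + 1)).eval (2 * x + (L + 1 : ℕ)) =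
      formula L k (2 * x + L + 1) (x * (x + L + 1)) := by
  obtain ⟨t, b, hb, rfl⟩ : ∃ t b, b ≤ 1 ∧ k = 2 * t + 1 + b :=
    ⟨(k - 1) / 2, (k - 1) % 2, by omega, by omega⟩
  -- `b` is the parity of `k + 1`, and the matrices have size `t + 1`
  have hinv (n : ℕ) : revProd (nodeSq (L + 1)) n * (revProd (nodeSq (L + 1)) n)⁻¹ = 1 :=
    PowerSeries.mul_inv_cancel _ (by rw [constantCoeff_revProd]; exact one_ne_zero)
  have hr : 2 * x + ((L + 1 : ℕ) : ℝ) = 2 * x + L + 1 := by push_cast; ring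
  have hz : 4 * (x * (x + L + 1)) + ((L : ℝ) + 1) ^ 2 = (2 * x + L + 1) ^ 2 := by ring
  have hdet : detFactor L (2 * t + 1 + b) (x * (x + L + 1)) =
      ((L + 1 + 1 + b + 2 * t).factorial : ℝ) *
        PowerSeries.coeff t (sinhc⁻¹ ^ (L + 1) * PowerSeries.mk fun j =>
          PowerSeries.coeff j ((1 - PowerSeries.C ((2 * x + L + 1) ^ 2) * PowerSeries.X)⁻¹ *
            (revProd (nodeSq (L + 1)) (L / 2 + 1))⁻¹) /
              ((L + 1 + 1 + b + 2 * j).factorial : ℝ)) := by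
    have hm : L + 3 - (2 * t + 1 + b) % 2 = L + 1 + 1 + b := by omega
    have hn : (2 * t + 1 + b + 1) / 2 = t + 1 := by omega
    simp only [detFactor, hm, hz]
    generalize (2 * t + 1 + b + 1) / 2 = n at hn
    subst hn
    refine det_unitLower_sub_K_add_K L (L + 1 + 1 + b) t _ ?_
    rw [mul_left_comm (revProd _ _), hinv, mul_one]
    exact PowerSeries.mul_inv_cancel _ (by rw [constantCoeff_one_sub]; exact one_ne_zero)
  have he : 2 * t + 1 + b + (L + 1) = L + 1 + 1 + b + 2 * t := by ring
  have hg : (L + 1 + 1) / 2 = L / 2 + 1 := by omega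
  have ha : (L + 1 + 1) % 2 = L % 2 := by omega
  have h4 := four_pow_mul_two_pow (L + 1)
  have hpow : (2 : ℝ) ^ (2 * t + 1 + b + (L + 1)) = 2 ^ (2 * t + 1 + b - 1) * 2 ^ (L + 1 + 1) := by
    rw [← pow_add]; congr 1; omega
  rw [hyperpoly, eval_mul, eval_C, noerlund, hpow, he,
    eval_vanishingPart_coeff (L + 1) b t hb _ _ (hinv _), eval_nodePoly_eq_prod, formula, hdet,
    ← h4, hr, hg, ha, show (2 * t + 1 + b + 1) % 2 = b by omega,
    show L + (2 * t + 1 + b) + 1 = L + 1 + 1 + b + 2 * t by ring]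
  have hfac : ((L + 1 + 1 + b + 2 * t).factorial : ℝ) ≠ 0 := by positivity
  have hL : 1 + ((L % 2 : ℕ) : ℝ) ≠ 0 := by positivity
  push_cast
  simp only [add_assoc, pow_add _ (L % 2) b] at hfac ⊢
  field_simp

end

end Hypersum

end

theorem theorem3 (L k : ℕ) (hk : 0 < k) :
    -- the hypersum polynomial, and the formula for it
    (∃! p : Polynomial ℝ,
      ∀ N : ℕ, p.eval (N : ℝ) = (Hypersum.hypersum k L N : ℝ)) ∧
    (∀ p : Polynomial ℝ,
      (∀ N : ℕ, p.eval (N : ℝ) = (Hypersum.hypersum k L N : ℝ)) →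
        -- with the square root, where it is equal to `2N+L+1`
        (∀ N : ℝ, -((L : ℝ) + 1) / 2 ≤ N →
          p.eval N = Hypersum.formula L k
            (Real.sqrt (4 * (N * (N + L + 1)) + ((L : ℝ) + 1) ^ 2)) (N * (N + L + 1))) ∧
        -- as a polynomial identity, the square root being read as `2N+L+1`
        (∀ N : ℝ,
          p.eval N = Hypersum.formula L k (2 * N + L + 1) (N * (N + L + 1)))) ∧
    -- the explicit factor contains the zeros at `N = 0, -1, …, -L-1`
    (∀ N : ℝ,
      (2 * N + L + 1) ^ (L % 2) / (1 + ((L % 2 : ℕ) : ℝ)) *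
          (∏ q ∈ Finset.range (L / 2 + 1),
            (N * (N + L + 1) + (q : ℝ) * ((L : ℝ) + 1 - (q : ℝ)))) =
        ∏ j ∈ Finset.range (L + 2), (N + (j : ℝ))) := by
  -- a polynomial is determined by its values at the natural numbers
  have huniq (p q : Polynomial ℝ) (h : ∀ N : ℕ, p.eval (N : ℝ) = q.eval (N : ℝ)) : p = q := by
    refine Polynomial.eq_of_infinite_eval_eq p q
      ((Set.infinite_range_of_injective (Nat.cast_injective (R := ℝ))).mono ?_)
    rintro _ ⟨N, rfl⟩
    exact h N
  set p₀ : Polynomial ℝ := (Hypersum.hyperpoly k (L + 1)).comp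
    (Polynomial.C 2 * Polynomial.X + Polynomial.C ((L + 1 : ℕ) : ℝ)) with hp₀
  have heval (x : ℝ) :
      p₀.eval x = (Hypersum.hyperpoly k (L + 1)).eval (2 * x + (L + 1 : ℕ)) := by
    simp only [hp₀, Polynomial.eval_comp, Polynomial.eval_add, Polynomial.eval_mul,
      Polynomial.eval_C, Polynomial.eval_X]
  have hval (N : ℕ) : p₀.eval (N : ℝ) = (Hypersum.hypersum k L N : ℝ) := by
    rw [heval, Hypersum.hypersum_eq_eval_hyperpoly hk]
  have hformula (N : ℝ) :
      p₀.eval N = Hypersum.formula L k (2 * N + L + 1) (N * (N + L + 1)) := by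
    rw [heval, Hypersum.eval_hyperpoly_eq_formula L k hk]
  refine ⟨⟨p₀, hval, fun p hp => huniq _ _ fun N => by rw [hp, hval]⟩, fun p hp => ?_,
    fun N => ?_⟩
  · obtain rfl : p = p₀ := huniq _ _ fun N => by rw [hp, hval]
    refine ⟨fun N hN => ?_, hformula⟩
    rw [hformula, show 4 * (N * (N + L + 1)) + ((L : ℝ) + 1) ^ 2 = (2 * N + L + 1) ^ 2 by ring,
      Real.sqrt_sq (by linarith)]
  · have h1 := Hypersum.eval_nodePoly (L + 1) N
    have h2 := Hypersum.four_pow_mul_two_pow (L + 1)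
    have hL : 1 + ((L % 2 : ℕ) : ℝ) ≠ 0 := by positivity
    rw [Hypersum.eval_nodePoly_eq_prod, ← h2, show (L + 1 + 1) / 2 = L / 2 + 1 by omega,
      show (L + 1 + 1) % 2 = L % 2 by omega] at h1
    push_cast at h1
    have h4 : (4 : ℝ) ^ (L / 2 + 1) ≠ 0 := by positivity
    rw [div_mul_eq_mul_div, div_eq_iff hL]
    refine mul_left_cancel₀ h4 ?_
    simp only [add_assoc] at h1 ⊢
    linear_combination h1
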